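/- **Setting.** Let $\ell>0$, $m\in\mathbb R$, $\alpha\in[0,\pi)$, $\beta_1,\beta_2,\beta_1',\beta_2'\in\mathbb R$ with $\rho:=\beta_1'\beta_2-\beta_1\beta_2'>0$, and let $V:[0,\ell]\to\mathbb R$ be continuous. Let $\mathcal H=L^2((0,\ell))\oplus\mathbb C$ with the inner product $(\varphi,\chi)=\int_0^\ell\overline{\varphi_1}\chi_1\,dz+\rho^{-1}\overline{\varphi_2}\chi_2$, and let $A$ be the operator in $\mathcal H$ whose domain $D(A)$ consists of the $\varphi=(\varphi_1,\varphi_2)\in\mathcal H$ such that $\varphi_1,\partial_z\varphi_1$ are absolutely continuous on $[0,\ell]$, $\partial_z^2\varphi_1\in L^2((0,\ell))$, $\cos\alpha\,\varphi_1(0)+\sin\alpha\,\partial_z\varphi_1(0)=0$ and $\varphi_2=\beta_1'\varphi_1(\ell)-\beta_2'\partial_z\varphi_1(\ell)$, with $$A\varphi=\bigl(-\partial_z^2\varphi_1+(m^2+V)\varphi_1,\;-[\beta_1\varphi_1(\ell)-\beta_2\partial_z\varphi_1(\ell)]\bigr).$$ $D(A)$ carries the graph norm $\|\varphi\|_{\mathcal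 H}+\|A\varphi\|_{\mathcal H}$. $C^2(\mathbb R,D(A))$ is the space of twice continuously differentiable functions $\mathbb R\to D(A)$, $C^2_0(\mathbb R,D(A))$ the subspace of those with compact support, and $Q_A=\partial_t^2+A$. For $O\subset\mathbb R\times[0,\ell]$, $J_\pm(O)$ is the set of $(t,z)\in\mathbb R\times[0,\ell]$ such that $|z-z_0|\le\pm(t-t_0)$ for some $(t_0,z_0)\in O$, and $J(O)=J_+(O)\cup J_-(O)$. For $f:\mathbb R\to D(A)$, $\operatorname{supp}f_1$ is the support of $(t,z)\mapsto f(t)_1(z)$ in $\mathbb R\times[0,\ell]$. An *integral operator* with kernel $E:\mathbb R\to\mathcal B(\mathcal H)$ is a map $\mathsf E:C^2_0(\mathbb R,D(A))\to C^2(\mathbb R,D(A))$ with $(\mathsf Ef)(t)=\int_{\mathbb R}E(t-t')f(t')\,dt'$ for all $f$ and $t$, where $E$ is locally bounded and $t\mapsto E(t)\varphi$ is strongly measurable for every $\varphi\in\mathcal H$. For a continuous compactly supported $g:\mathbb R\to\mathcal H$, such as $g=Q_Af$, $\mathsf Eg$ is defined by the same integral. * $\mathsf E$ is a *causal propagator*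 if it is an integral operator with a kernel $E$ such that $t\mapsto E(t)\varphi\in\mathcal H$ is twice continuously differentiable for every $\varphi\in D(A)$, $Q_A\mathsf Ef=\mathsf EQ_Af=0$ and $\operatorname{supp}(\mathsf Ef)_1\subset J(\operatorname{supp}f_1)$ for all $f\in C^2_0(\mathbb R,D(A))$, $E(0)=0$, and $\partial_tE(t)\varphi|_{t=0}=-\varphi$ for all $\varphi\in D(A)$. * $\mathsf E$ is a *retarded* (respectively *advanced*) *Green's operator* if it is an integral operator with $Q_A\mathsf Ef=\mathsf EQ_Af=f$ and $\operatorname{supp}(\mathsf Ef)_1\subset J_-(\operatorname{supp}f_1)$ (respectively $\subset J_+(\operatorname{supp}f_1)$) for all $f\in C^2_0(\mathbb R,D(A))$. **Theorem.** Suppose that $m^2+V\ge0$ on $[0,\ell]$, that $\alpha=0$ or $\pi/2\le\alpha<\pi$, that $\beta_2\ne0$ and $\beta_2'\neq0$, that $\beta_1\ge0$, $\beta_2<0$, $\beta_1'<0$ if $\beta_2'>0$, and that $\beta_1\le0$, $\beta_2>0$, $\beta_1'>0$ if $\beta_2'<0$. Then any two advanced Green's operators are equal, any two retarded Green's operators are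 equal, and any two causal propagators are equal. -/

import Mathlib

open Set MeasureTheory

/-! ### The bulk-boundary system -/

/-- The data of the bulk-boundary system: a bulk Klein-Gordon field on `[0, ℓ]` of mass `m` in a
continuous potential `V`, with a Dirichlet or Robin condition (angle `α ∈ [0, π)`) at `0` and a
dynamical boundary condition with coefficients `β₁, β₂, β₁', β₂'` at `ℓ`, whose determinant
`ρ = β₁' β₂ - β₁ β₂'` is positive. -/
structure BulkBoundarySystem where
  ℓ : ℝ
  m : ℝ
  α : ℝ
  β₁ : ℝ
  β₂ : ℝ
  β₁' : ℝ
  β₂' : ℝ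
  V : ℝ → ℝ
  ℓ_pos : 0 < ℓ
  α_mem : α ∈ Ico 0 Real.pi
  V_cont : ContinuousOn V (Icc 0 ℓ)
  det_pos : 0 < β₁' * β₂ - β₁ * β₂'

/-! ### A partially defined operator and its domain with the graph norm -/

/-- The domain of a partially defined linear operator, to be endowed with the graph norm. -/
def GraphDomain {E : Type*} [NormedAddCommGroup E] [NormedSpace ℂ E] (A : E →ₗ.[ℂ] E) : Type _ :=
  A.domain

namespace GraphDomain

variable {E : Type*} [NormedAddCommGroup E] [NormedSpace ℂ E] (A : E →ₗ.[ℂ] E)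

noncomputable instance : AddCommGroup (GraphDomain A) := inferInstanceAs (AddCommGroup A.domain)

noncomputable instance : Module ℂ (GraphDomain A) := inferInstanceAs (Module ℂ A.domain)

/-- The inclusion of the domain into the ambient space. -/
def incl : GraphDomain A →ₗ[ℂ] E := A.domain.subtype

/-- The operator, as a linear map on its domain. -/
def op : GraphDomain A →ₗ[ℂ] E := A.toFun

/-- The map `φ ↦ (φ, A φ)` into `E × E` with the sum norm. -/
noncomputable def toGraph : GraphDomain A →ₗ[ℂ] WithLp 1 (E × E) :=
  (WithLp.linearEquiv 1 ℂ (E × E)).symm.toLinearMap ∘ₗ ((incl A).prod (op A))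

theorem incl_injective : Function.Injective (incl A) := Subtype.val_injective

theorem toGraph_injective : Function.Injective (toGraph A) := fun _ _ h =>
  incl_injective A (congrArg WithLp.fst h)

noncomputable instance : NormedAddCommGroup (GraphDomain A) :=
  NormedAddCommGroup.induced (GraphDomain A) (WithLp 1 (E × E)) (toGraph A) (toGraph_injective A)

noncomputable instance : NormedSpace ℂ (GraphDomain A) :=
  NormedSpace.induced ℂ (GraphDomain A) (WithLp 1 (E × E)) (toGraph A)

/-- The norm is the graph norm. -/
theorem norm_def (φ : GraphDomain A) : ‖φ‖ = ‖incl A φ‖ + ‖op A φ‖ :=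
  WithLp.prod_norm_eq_of_L1 (toGraph A φ)

end GraphDomain

namespace BulkBoundarySystem

/-- The determinant `ρ`. -/
def ρ (S : BulkBoundarySystem) : ℝ := S.β₁' * S.β₂ - S.β₁ * S.β₂'

theorem ρ_pos (S : BulkBoundarySystem) : 0 < S.ρ := S.det_pos

/-! ### The Hilbert space `ℋ = L²(0, ℓ) ⊕ ℂ` -/

/-- The boundary summand `ℂ` with the inner product `(a, b) ↦ ρ⁻¹ * conj a * b`. -/
def BoundarySpace (_S : BulkBoundarySystem) : Type := ℂ

noncomputable instance (S : BulkBoundarySystem) : AddCommGroup S.BoundarySpace :=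
  inferInstanceAs (AddCommGroup ℂ)

noncomputable instance (S : BulkBoundarySystem) : Module ℂ S.BoundarySpace :=
  inferInstanceAs (Module ℂ ℂ)

/-- The weighted inner product on the boundary summand. -/
@[reducible]
noncomputable def boundaryCore (S : BulkBoundarySystem) :
    InnerProductSpace.Core ℂ S.BoundarySpace where
  inner a b := (S.ρ : ℂ)⁻¹ * ((starRingEnd ℂ) (show ℂ from a) * (show ℂ from b))
  conj_inner_symm a b := by
    change (starRingEnd ℂ) ((S.ρ : ℂ)⁻¹ * ((starRingEnd ℂ) (show ℂ from b) * (show ℂ from a))) =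
      (S.ρ : ℂ)⁻¹ * ((starRingEnd ℂ) (show ℂ from a) * (show ℂ from b))
    rw [map_mul, map_mul, map_inv₀, Complex.conj_ofReal, Complex.conj_conj]
    ring
  re_inner_nonneg a := by
    rw [← Complex.normSq_eq_conj_mul_self, ← Complex.ofReal_inv, ← Complex.ofReal_mul]
    exact mul_nonneg (inv_nonneg.2 S.ρ_pos.le) (Complex.normSq_nonneg _)
  add_left a b c := by
    change (S.ρ : ℂ)⁻¹ * ((starRingEnd ℂ) ((show ℂ from a) + (show ℂ from b)) * (show ℂ from c)) = _
    rw [map_add]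
    ring
  smul_left a b r := by
    change (S.ρ : ℂ)⁻¹ * ((starRingEnd ℂ) (r * (show ℂ from a)) * (show ℂ from b)) = _
    rw [map_mul]
    ring
  definite a h := by
    have h' : (S.ρ : ℂ)⁻¹ * ((starRingEnd ℂ) (show ℂ from a) * (show ℂ from a)) = 0 := h
    have hρ : (S.ρ : ℂ) ≠ 0 := Complex.ofReal_ne_zero.2 S.ρ_pos.ne'
    rw [← Complex.normSq_eq_conj_mul_self] at h'
    have h2 := (mul_eq_zero.1 h').resolve_left (inv_ne_zero hρ)
    exact Complex.normSq_eq_zero.1 (Complex.ofReal_eq_zero.1 h2)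

noncomputable instance (S : BulkBoundarySystem) : NormedAddCommGroup S.BoundarySpace :=
  S.boundaryCore.toNormedAddCommGroup

noncomputable instance (S : BulkBoundarySystem) : InnerProductSpace ℂ S.BoundarySpace :=
  InnerProductSpace.ofCore S.boundaryCore.toCore

instance (S : BulkBoundarySystem) : CompleteSpace S.BoundarySpace :=
  haveI : FiniteDimensional ℂ S.BoundarySpace := inferInstanceAs (FiniteDimensional ℂ ℂ)
  FiniteDimensional.complete ℂ S.BoundarySpace

/-- Lebesgue measure on `(0, ℓ)`. -/
noncomputable def μ (S : BulkBoundarySystem) : Measure ℝ := volume.restrict (Ioo 0 S.ℓ)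

/-- The Hilbert space `ℋ = L²(0, ℓ) ⊕ ℂ`, the orthogonal sum, with the weight `ρ⁻¹` on `ℂ`. -/
abbrev H (S : BulkBoundarySystem) : Type := WithLp 2 (Lp ℂ 2 S.μ × S.BoundarySpace)

theorem inner_H (S : BulkBoundarySystem) (φ χ : S.H) :
    inner ℂ φ χ = (∫ z in Ioo 0 S.ℓ, (starRingEnd ℂ) (φ.fst z) * χ.fst z)
      + (S.ρ : ℂ)⁻¹ * ((starRingEnd ℂ) (show ℂ from φ.snd) * (show ℂ from χ.snd)) := by
  rw [WithLp.prod_inner_apply]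
  congr 1
  rw [L2.inner_def]
  refine integral_congr_ae (Filter.Eventually.of_forall fun z => ?_)
  simp only [RCLike.inner_apply]
  exact mul_comm _ _

/-! ### The operator `A` -/

/-- The pair `(φ, χ)` lies in the graph of `A`, i.e. `φ ∈ D(A)` and `A φ = χ`. Here `u`, `v`, `w`
are `φ₁`, `∂_z φ₁` and `∂_z² φ₁`. -/
def IsGraphPair (S : BulkBoundarySystem) (φ χ : S.H) : Prop :=
  ∃ u v w : ℝ → ℂ,
    φ.fst =ᵐ[S.μ] u ∧
    AbsolutelyContinuousOnInterval u 0 S.ℓ ∧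
    AbsolutelyContinuousOnInterval v 0 S.ℓ ∧
    (∀ z ∈ Icc 0 S.ℓ, HasDerivWithinAt u (v z) (Icc 0 S.ℓ) z) ∧
    (∀ᵐ z ∂S.μ, HasDerivAt v (w z) z) ∧
    MemLp w 2 S.μ ∧
    (Real.cos S.α : ℂ) * u 0 + (Real.sin S.α : ℂ) * v 0 = 0 ∧
    φ.snd = ((S.β₁' : ℂ) * u S.ℓ - (S.β₂' : ℂ) * v S.ℓ : ℂ) ∧
    χ.fst =ᵐ[S.μ] (fun z => -w z + ((S.m : ℂ) ^ 2 + (S.V z : ℂ)) * u z) ∧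
    χ.snd = (-((S.β₁ : ℂ) * u S.ℓ - (S.β₂ : ℂ) * v S.ℓ) : ℂ)

/-- The graph of `A`. -/
def graphA (S : BulkBoundarySystem) : Submodule ℂ (S.H × S.H) where
  carrier := {p | S.IsGraphPair p.1 p.2}
  zero_mem' := by
    refine ⟨0, 0, 0, Lp.coeFn_zero ℂ 2 S.μ, ?_, ?_, fun z _ => hasDerivWithinAt_const z _ (0 : ℂ),
      Filter.Eventually.of_forall fun z => hasDerivAt_const z (0 : ℂ), MemLp.zero, by simp, ?_, ?_, ?_⟩
    · simpa [AbsolutelyContinuousOnInterval] using tendsto_const_nhds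
    · simpa [AbsolutelyContinuousOnInterval] using tendsto_const_nhds
    · simp; rfl
    · filter_upwards [Lp.coeFn_zero ℂ 2 S.μ] with z hz
      simpa using hz
    · simp; rfl
  add_mem' := by
    rintro ⟨φ, χ⟩ ⟨φ', χ'⟩ ⟨u, v, w, h1, h2, h3, h4, h5, h6, h7, h8, h9, h10⟩
      ⟨u', v', w', k1, k2, k3, k4, k5, k6, k7, k8, k9, k10⟩
    refine ⟨u + u', v + v', w + w', ?_, h2.add k2, h3.add k3,
      fun z hz => (h4 z hz).add (k4 z hz), ?_, h6.add k6, ?_, ?_, ?_, ?_⟩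
    · filter_upwards [h1, k1, Lp.coeFn_add φ.fst φ'.fst] with z a b c
      simp only [Prod.mk_add_mk, WithLp.add_fst, c, Pi.add_apply, a, b]
    · filter_upwards [h5, k5] with z a b using a.add b
    · simp only [Pi.add_apply]
      linear_combination h7 + k7
    · simp only [Prod.mk_add_mk, WithLp.add_snd, h8, k8, Pi.add_apply]
      change (_ : ℂ) + _ = _
      ring
    · filter_upwards [h9, k9, Lp.coeFn_add χ.fst χ'.fst] with z a b c
      simp only [Prod.mk_add_mk, WithLp.add_fst, c, Pi.add_apply, a, b]
      ring
    · simp only [Prod.mk_add_mk, WithLp.add_snd, h10, k10, Pi.add_apply]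
      change (_ : ℂ) + _ = _
      ring
  smul_mem' := by
    rintro r ⟨φ, χ⟩ ⟨u, v, w, h1, h2, h3, h4, h5, h6, h7, h8, h9, h10⟩
    refine ⟨fun z => r • u z, fun z => r • v z, r • w, ?_, h2.const_smul r, h3.const_smul r,
      fun z hz => (h4 z hz).const_smul r, ?_, h6.const_smul r, ?_, ?_, ?_, ?_⟩
    · filter_upwards [h1, Lp.coeFn_smul r φ.fst] with z a c
      simp only [Prod.smul_mk, WithLp.smul_fst, c, Pi.smul_apply, a]
    · filter_upwards [h5] with z a using a.const_smul r
    · simp only [smul_eq_mul]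
      linear_combination r * h7
    · simp only [Prod.smul_mk, WithLp.smul_snd, h8, smul_eq_mul]
      change r * (_ : ℂ) = _
      ring
    · filter_upwards [h9, Lp.coeFn_smul r χ.fst] with z a c
      simp only [Prod.smul_mk, WithLp.smul_fst, c, Pi.smul_apply, a, smul_eq_mul]
      ring
    · simp only [Prod.smul_mk, WithLp.smul_snd, h10, smul_eq_mul]
      change r * (_ : ℂ) = _
      ring

/-- Functions continuous on `[0, ℓ]` that agree almost everywhere agree on `[0, ℓ]`. -/
theorem eqOn_of_ae (S : BulkBoundarySystem) {u u' : ℝ → ℂ} (h : u =ᵐ[S.μ] u')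
    (hu : ContinuousOn u (Icc 0 S.ℓ)) (hu' : ContinuousOn u' (Icc 0 S.ℓ)) :
    EqOn u u' (Icc 0 S.ℓ) := by
  have h0 : EqOn u u' (Ioo 0 S.ℓ) :=
    Measure.eqOn_open_of_ae_eq h isOpen_Ioo (hu.mono Ioo_subset_Icc_self)
      (hu'.mono Ioo_subset_Icc_self)
  refine h0.of_subset_closure hu hu' Ioo_subset_Icc_self ?_
  rw [closure_Ioo S.ℓ_pos.ne]

/-- The graph is that of a single-valued operator. -/
theorem graphA_single (S : BulkBoundarySystem) (p : S.H × S.H) (hp : p ∈ S.graphA)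
    (h0 : p.1 = 0) : p.2 = 0 := by
  obtain ⟨φ, χ⟩ := p
  obtain ⟨u, v, w, h1, h2, h3, h4, h5, -, -, -, h9, h10⟩ := hp
  dsimp only at h0 h1 h9 h10
  subst h0
  have hu : EqOn u 0 (Icc 0 S.ℓ) := by
    refine S.eqOn_of_ae (h1.symm.trans (Lp.coeFn_zero ℂ 2 S.μ)) ?_ continuousOn_const
    simpa [uIcc_of_le S.ℓ_pos.le] using h2.continuousOn
  have hv : EqOn v 0 (Icc 0 S.ℓ) := fun z hz => by
    have a := (hasDerivWithinAt_const z (Icc 0 S.ℓ) (0 : ℂ)).congr hu (hu hz)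
    exact (uniqueDiffOn_Icc S.ℓ_pos z hz).eq_deriv _ (h4 z hz) a
  have hw : w =ᵐ[S.μ] 0 := by
    filter_upwards [h5, ae_restrict_mem (measurableSet_Ioo (a := (0 : ℝ)) (b := S.ℓ))] with z a hz
    have b : HasDerivAt v 0 z := (hasDerivAt_const z (0 : ℂ)).congr_of_eventuallyEq
      (Filter.eventuallyEq_of_mem (Icc_mem_nhds hz.1 hz.2) hv)
    exact a.unique b
  have hχ : χ.fst = 0 := by
    refine Lp.ext ?_
    filter_upwards [h9, hw, Lp.coeFn_zero ℂ 2 S.μ,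
      ae_restrict_mem (measurableSet_Ioo (a := (0 : ℝ)) (b := S.ℓ))] with z a b c hz
    rw [a, c, b, hu (Ioo_subset_Icc_self hz)]
    simp
  have hχ' : χ.snd = 0 := by
    rw [h10, hu (right_mem_Icc.2 S.ℓ_pos.le), hv (right_mem_Icc.2 S.ℓ_pos.le)]
    simp
    rfl
  exact WithLp.ofLp_injective 2 (Prod.ext hχ hχ')

/-- The operator `A` in `ℋ`. -/
noncomputable def A (S : BulkBoundarySystem) : S.H →ₗ.[ℂ] S.H := S.graphA.toLinearPMap

theorem mem_graph_A (S : BulkBoundarySystem) (φ χ : S.H) :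
    (φ, χ) ∈ S.A.graph ↔ S.IsGraphPair φ χ := by
  rw [A, Submodule.toLinearPMap_graph_eq _ S.graphA_single]
  rfl

/-- `D(A)` with the graph norm. -/
abbrev DA (S : BulkBoundarySystem) : Type := GraphDomain S.A

/-- The inclusion of `D(A)` in `ℋ`. -/
noncomputable abbrev toH (S : BulkBoundarySystem) : S.DA →ₗ[ℂ] S.H := GraphDomain.incl S.A

/-- `A` as a map from `D(A)` to `ℋ`. -/
noncomputable abbrev opA (S : BulkBoundarySystem) : S.DA →ₗ[ℂ] S.H := GraphDomain.op S.A

theorem isGraphPair (S : BulkBoundarySystem) (φ : S.DA) : S.IsGraphPair (S.toH φ) (S.opA φ) :=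
  (S.mem_graph_A _ _).1 (S.A.mem_graph φ)

theorem exists_rep (S : BulkBoundarySystem) (φ : S.DA) :
    ∃ u : ℝ → ℂ, ContinuousOn u (Icc 0 S.ℓ) ∧ (S.toH φ).fst =ᵐ[S.μ] u := by
  obtain ⟨u, -, -, h1, h2, -⟩ := S.isGraphPair φ
  exact ⟨u, by simpa [uIcc_of_le S.ℓ_pos.le] using h2.continuousOn, h1⟩

/-- The bulk component `φ₁` of `φ ∈ D(A)` as a function on `[0, ℓ]`: the continuous representative
(unique on `[0, ℓ]`; the values elsewhere are never used). -/
noncomputable def bulk (S : BulkBoundarySystem) (φ : S.DA) : ℝ → ℂ := (S.exists_rep φ).choose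

theorem bulk_spec (S : BulkBoundarySystem) (φ : S.DA) :
    ContinuousOn (S.bulk φ) (Icc 0 S.ℓ) ∧ (S.toH φ).fst =ᵐ[S.μ] S.bulk φ :=
  (S.exists_rep φ).choose_spec

/-! ### Supports and causal structure of `ℝ × [0, ℓ]`; a point is `(t, z)` -/

/-- The support in `ℝ × [0, ℓ]` of the bulk component `f₁` of `f : ℝ → D(A)`. -/
def suppBulk (S : BulkBoundarySystem) (f : ℝ → S.DA) : Set (ℝ × ℝ) :=
  closure {x | x.2 ∈ Icc 0 S.ℓ ∧ S.bulk (f x.1) x.2 ≠ 0}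

/-- The causal future of a set in `ℝ × [0, ℓ]`. -/
def JPlus (S : BulkBoundarySystem) (O : Set (ℝ × ℝ)) : Set (ℝ × ℝ) :=
  {x | x.2 ∈ Icc 0 S.ℓ ∧ ∃ y ∈ O, |x.2 - y.2| ≤ x.1 - y.1}

/-- The causal past of a set in `ℝ × [0, ℓ]`. -/
def JMinus (S : BulkBoundarySystem) (O : Set (ℝ × ℝ)) : Set (ℝ × ℝ) :=
  {x | x.2 ∈ Icc 0 S.ℓ ∧ ∃ y ∈ O, |x.2 - y.2| ≤ y.1 - x.1}

/-! ### Function spaces and integral operators -/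

/-- `C²(ℝ, D(A))`. -/
def C2 (S : BulkBoundarySystem) : Type := {f : ℝ → S.DA // ContDiff ℝ 2 f}

/-- `C²₀(ℝ, D(A))`. -/
def C2c (S : BulkBoundarySystem) : Type := {f : ℝ → S.DA // ContDiff ℝ 2 f ∧ HasCompactSupport f}

/-- The Klein-Gordon operator `Q_A = ∂²/∂t² + A`. -/
noncomputable def Q (S : BulkBoundarySystem) (f : ℝ → S.DA) (t : ℝ) : S.H :=
  S.toH (iteratedDeriv 2 f t) + S.opA (f t)

/-- The function `t ↦ ∫ E(t - t') g(t') dt'` for a kernel `E : ℝ → 𝓑(ℋ)`. -/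
noncomputable def convolve (S : BulkBoundarySystem) (E : ℝ → S.H →L[ℂ] S.H) (g : ℝ → S.H)
    (t : ℝ) : S.H :=
  ∫ t', E (t - t') (g t')

/-- `T` is an integral operator from `C²₀(ℝ, D(A))` into `C²(ℝ, D(A))` with integral kernel `E`, a
locally bounded and strongly measurable family of bounded operators on `ℋ`. -/
structure IsIntegralOperator (S : BulkBoundarySystem) (T : S.C2c → S.C2)
    (E : ℝ → S.H →L[ℂ] S.H) : Prop where
  measurable : ∀ φ : S.H, StronglyMeasurable fun t => E t φ
  locally_bounded : ∀ R : ℝ, ∃ C : ℝ, ∀ t, |t| ≤ R → ‖E t‖ ≤ C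
  eq_integral : ∀ (f : S.C2c) (t : ℝ),
    S.toH ((T f).1 t) = S.convolve E (fun t' => S.toH (f.1 t')) t

/-- A causal propagator. Its kernel is twice continuously differentiable strongly on `D(A)`. -/
def IsCausalPropagator (S : BulkBoundarySystem) (T : S.C2c → S.C2) : Prop :=
  ∃ E : ℝ → S.H →L[ℂ] S.H,
    S.IsIntegralOperator T E ∧
    (∀ φ : S.DA, ContDiff ℝ 2 fun t => E t (S.toH φ)) ∧
    (∀ (f : S.C2c) (t : ℝ), S.Q (T f).1 t = 0) ∧
    (∀ (f : S.C2c) (t : ℝ), S.convolve E (S.Q f.1) t = 0) ∧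
    (∀ f : S.C2c, S.suppBulk (T f).1 ⊆ S.JPlus (S.suppBulk f.1) ∪ S.JMinus (S.suppBulk f.1)) ∧
    E 0 = 0 ∧
    (∀ φ : S.DA, HasDerivAt (fun t => E t (S.toH φ)) (-S.toH φ) 0)

/-- A retarded Green's operator (in the convention that it propagates into the causal past). -/
def IsRetardedGreen (S : BulkBoundarySystem) (T : S.C2c → S.C2) : Prop :=
  ∃ E : ℝ → S.H →L[ℂ] S.H,
    S.IsIntegralOperator T E ∧
    (∀ (f : S.C2c) (t : ℝ), S.Q (T f).1 t = S.toH (f.1 t)) ∧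
    (∀ (f : S.C2c) (t : ℝ), S.convolve E (S.Q f.1) t = S.toH (f.1 t)) ∧
    (∀ f : S.C2c, S.suppBulk (T f).1 ⊆ S.JMinus (S.suppBulk f.1))

/-- An advanced Green's operator (in the convention that it propagates into the causal future). -/
def IsAdvancedGreen (S : BulkBoundarySystem) (T : S.C2c → S.C2) : Prop :=
  ∃ E : ℝ → S.H →L[ℂ] S.H,
    S.IsIntegralOperator T E ∧
    (∀ (f : S.C2c) (t : ℝ), S.Q (T f).1 t = S.toH (f.1 t)) ∧
    (∀ (f : S.C2c) (t : ℝ), S.convolve E (S.Q f.1) t = S.toH (f.1 t)) ∧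
    (∀ f : S.C2c, S.suppBulk (T f).1 ⊆ S.JPlus (S.suppBulk f.1))

end BulkBoundarySystem

/-! Everything rests on the nonnegativity of the quadratic form of `A`. Integrating by parts in `(φ,
A φ)` leaves the integral of `|∂_z φ₁|² + (m² + V)|φ₁|²` and boundary terms at `0` and `ℓ`. The sign
conditions on `α` and on the `β`'s make each of these nonnegative
(`exists_inner_eq_of_isGraphPair`).

A real form gives a symmetric operator by polarization, so the energy `‖∂ₜ g‖² + (g, A g)` of a
solution of `Q_A g = 0` is conserved. Both terms are nonnegative; a solution with zero energy at one
time is therefore constant.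

Green's operators: for fixed `f`, the outputs of two advanced operators differ by a solution of `Q_A
h = 0` that vanishes at early times, because the causal future of a set bounded in time is bounded
below in time. Its energy is zero, hence so is `h`. The retarded case uses late times.

Causal propagators: here the initial data of the kernels are compared. The obstacle is that `E(t) φ`
is not known to lie in `D(A)`, so its energy is not defined. Its mollifications are `D(A)`-valued,
being the values of the propagator on `η(t) φ`. For these the energy inequality can be written
without `A`, using `A G = -∂ₜ² G`, and it then survives the limit in `ℋ` (`norm_sq_convolution_le`,
`eq_zero_of_mollified_wave`). -/

open Filter Topology
open scoped Convolution

/-! ### Integration by parts for absolutely continuous complex functions -/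

/-- Serves to pass absolute continuity to real parts, imaginary parts and conjugates. -/
theorem AbsolutelyContinuousOnInterval.comp_of_dist_le {X Y : Type*} [PseudoMetricSpace X]
    [PseudoMetricSpace Y] {f : ℝ → X} {g : ℝ → Y} {a b : ℝ}
    (hf : AbsolutelyContinuousOnInterval f a b) (h : ∀ x y, dist (g x) (g y) ≤ dist (f x) (f y)) :
    AbsolutelyContinuousOnInterval g a b := by
  unfold AbsolutelyContinuousOnInterval at hf ⊢
  exact squeeze_zero (fun t => Finset.sum_nonneg fun i _ => dist_nonneg)
    (fun t => Finset.sum_le_sum fun i _ => h _ _) hf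

theorem AbsolutelyContinuousOnInterval.setIntegral_Ioo_eq_sub_real {f f' : ℝ → ℝ} {a b : ℝ}
    (hab : a ≤ b) (hf : AbsolutelyContinuousOnInterval f a b)
    (hf' : ∀ᵐ z ∂volume.restrict (Ioo a b), HasDerivAt f (f' z) z) :
    ∫ z in Ioo a b, f' z = f b - f a := by
  rw [← hf.integral_deriv_eq_sub, intervalIntegral.integral_of_le hab,
    integral_Ioc_eq_integral_Ioo]
  refine integral_congr_ae ?_
  filter_upwards [hf'] with z hz using hz.deriv.symm

/-- The fundamental theorem of calculus for absolutely continuous complex functions. -/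
theorem AbsolutelyContinuousOnInterval.setIntegral_Ioo_eq_sub {f f' : ℝ → ℂ} {a b : ℝ}
    (hab : a ≤ b) (hf : AbsolutelyContinuousOnInterval f a b)
    (hf' : ∀ᵐ z ∂volume.restrict (Ioo a b), HasDerivAt f (f' z) z)
    (hi : IntegrableOn f' (Ioo a b)) :
    ∫ z in Ioo a b, f' z = f b - f a := by
  have hre : AbsolutelyContinuousOnInterval (fun z => (f z).re) a b :=
    hf.comp_of_dist_le fun x y => by
      rw [Real.dist_eq, dist_eq_norm, ← Complex.sub_re]
      exact Complex.abs_re_le_norm _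
  have him : AbsolutelyContinuousOnInterval (fun z => (f z).im) a b :=
    hf.comp_of_dist_le fun x y => by
      rw [Real.dist_eq, dist_eq_norm, ← Complex.sub_im]
      exact Complex.abs_im_le_norm _
  have h1 := hre.setIntegral_Ioo_eq_sub_real (f' := fun z => (f' z).re) hab <| by
    filter_upwards [hf'] with z hz
    exact Complex.reCLM.hasFDerivAt.comp_hasDerivAt z hz
  have h2 := him.setIntegral_Ioo_eq_sub_real (f' := fun z => (f' z).im) hab <| by
    filter_upwards [hf'] with z hz
    exact Complex.imCLM.hasFDerivAt.comp_hasDerivAt z hz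
  apply Complex.ext
  · rw [Complex.sub_re, ← h1]
    exact (integral_re hi).symm
  · rw [Complex.sub_im, ← h2]
    exact (integral_im hi).symm

namespace BulkBoundarySystem

/-! ### The quadratic form of `A` -/

/-- The boundary contribution at `ℓ` to the quadratic form of `A`. -/
theorem boundary_form_right (S : BulkBoundarySystem)
    (hβ₂' : S.β₂' ≠ 0)
    (hpos : 0 < S.β₂' → 0 ≤ S.β₁ ∧ S.β₂ < 0 ∧ S.β₁' < 0)
    (hneg : S.β₂' < 0 → S.β₁ ≤ 0 ∧ 0 < S.β₂ ∧ 0 < S.β₁') (a b : ℂ) :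
    ∃ r : ℝ, 0 ≤ r ∧ -((starRingEnd ℂ) a * b) + (S.ρ : ℂ)⁻¹ *
      ((starRingEnd ℂ) ((S.β₁' : ℂ) * a - (S.β₂' : ℂ) * b) *
        (-((S.β₁ : ℂ) * a - (S.β₂ : ℂ) * b))) = r := by
  have hρ := S.ρ_pos
  have hρ' : S.ρ = S.β₁' * S.β₂ - S.β₁ * S.β₂' := rfl
  -- Since `-ρ + β₁' β₂ = β₁ β₂'`, the mixed terms combine to `β₁ β₂' (conj a * b + conj b * a)`,
  -- which is real: the weight `ρ⁻¹` in the inner product is what makes this happen.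
  refine ⟨S.ρ⁻¹ * (-(S.β₁' * S.β₁) * (a.re * a.re + a.im * a.im) - S.β₂' * S.β₂ * (b.re * b.re + b.im * b.im)
    + 2 * (S.β₁ * S.β₂') * (a.re * b.re + a.im * b.im)), ?_, ?_⟩
  · refine mul_nonneg (inv_nonneg.2 hρ.le) ?_
    have key : 0 ≤ -(S.β₁' * S.β₁) ∧ 0 < -(S.β₂' * S.β₂) ∧ 0 ≤ S.β₁ * S.β₂' := by
      rcases lt_or_gt_of_ne hβ₂' with h | h
      · obtain ⟨h1, h2, h3⟩ := hneg h
        exact ⟨by nlinarith, by nlinarith, by nlinarith⟩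
      · obtain ⟨h1, h2, h3⟩ := hpos h
        exact ⟨by nlinarith, by nlinarith, by nlinarith⟩
    obtain ⟨k1, k2, k3⟩ := key
    -- The form has matrix `(P, q; q, R)` with `R > 0`, and its determinant factors as `q * ρ`.
    have hdet : (S.β₁ * S.β₂') ^ 2 ≤ (-(S.β₁' * S.β₁)) * (-(S.β₂' * S.β₂)) := by
      have : (-(S.β₁' * S.β₁)) * (-(S.β₂' * S.β₂)) - (S.β₁ * S.β₂') ^ 2
          = (S.β₁ * S.β₂') * S.ρ := by rw [hρ']; ring
      have := mul_nonneg k3 hρ.le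
      linarith
    generalize -(S.β₁' * S.β₁) = P at *
    have e : S.β₂' * S.β₂ = -(-(S.β₂' * S.β₂)) := by ring
    rw [e]
    generalize -(S.β₂' * S.β₂) = R at *
    generalize S.β₁ * S.β₂' = q at *
    -- Complete the square: `R (P x² + 2 q x y + R y²) = (R y + q x)² + (P R - q²) x²`, for real and
    -- imaginary parts separately.
    refine nonneg_of_mul_nonneg_right (a := R) ?_ k2
    nlinarith [sq_nonneg (R * b.re + q * a.re), sq_nonneg (R * b.im + q * a.im),
      mul_nonneg (sub_nonneg.2 hdet) (sq_nonneg a.re),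
      mul_nonneg (sub_nonneg.2 hdet) (sq_nonneg a.im)]
  · have hc : (S.ρ : ℂ) ≠ 0 := Complex.ofReal_ne_zero.2 hρ.ne'
    rw [Complex.ofReal_mul, Complex.ofReal_inv]
    rw [eq_inv_mul_iff_mul_eq₀ hc, mul_add, mul_inv_cancel_left₀ hc]
    have hρc : (S.ρ : ℂ) = S.β₁' * S.β₂ - S.β₁ * S.β₂' := by rw [hρ']; push_cast; ring
    rw [hρc]
    apply Complex.ext
    · simp; ring
    · simp; ring

/-- The boundary contribution at `0` to the quadratic form of `A`. -/
theorem boundary_form_left (S : BulkBoundarySystem)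
    (hα : S.α = 0 ∨ (Real.pi / 2 ≤ S.α ∧ S.α < Real.pi)) {a b : ℂ}
    (h : (Real.cos S.α : ℂ) * a + (Real.sin S.α : ℂ) * b = 0) :
    ∃ r : ℝ, 0 ≤ r ∧ (starRingEnd ℂ) a * b = r := by
  rcases hα with h0 | ⟨h1, h2⟩
  · rw [h0] at h
    have : a = 0 := by simpa using h
    exact ⟨0, le_rfl, by simp [this]⟩
  · have hs : 0 < Real.sin S.α := Real.sin_pos_of_pos_of_lt_pi (by linarith [Real.pi_pos]) h2
    have hc : Real.cos S.α ≤ 0 :=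
      Real.cos_nonpos_of_pi_div_two_le_of_le h1 (by linarith [Real.pi_pos])
    -- The Robin condition reads `b = -cot α * a`, and `cot α ≤ 0` in this range.
    refine ⟨-Real.cos S.α / Real.sin S.α * Complex.normSq a,
      mul_nonneg (div_nonneg (by linarith) hs.le) (Complex.normSq_nonneg a), ?_⟩
    have hs' : (Real.sin S.α : ℂ) ≠ 0 := Complex.ofReal_ne_zero.2 hs.ne'
    rw [Complex.ofReal_mul, Complex.normSq_eq_conj_mul_self, Complex.ofReal_div,
      Complex.ofReal_neg]
    field_simp
    linear_combination (starRingEnd ℂ) a * h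

/-- The quadratic form of `A` is nonnegative. -/
theorem exists_inner_eq_of_isGraphPair (S : BulkBoundarySystem)
    (hmV : ∀ z ∈ Set.Icc 0 S.ℓ, 0 ≤ S.m ^ 2 + S.V z)
    (hα : S.α = 0 ∨ (Real.pi / 2 ≤ S.α ∧ S.α < Real.pi))
    (hβ₂' : S.β₂' ≠ 0)
    (hpos : 0 < S.β₂' → 0 ≤ S.β₁ ∧ S.β₂ < 0 ∧ S.β₁' < 0)
    (hneg : S.β₂' < 0 → S.β₁ ≤ 0 ∧ 0 < S.β₂ ∧ 0 < S.β₁')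
    {φ χ : S.H} (h : S.IsGraphPair φ χ) :
    ∃ r : ℝ, 0 ≤ r ∧ inner ℂ φ χ = (r : ℂ) := by
  obtain ⟨u, v, w, h1, h2, h3, h4, h5, h6, h7, h8, h9, h10⟩ := h
  obtain ⟨r₁, hr₁, e₁⟩ := S.boundary_form_left hα h7
  obtain ⟨r₂, hr₂, e₂⟩ := S.boundary_form_right hβ₂' hpos hneg (u S.ℓ) (v S.ℓ)
  have hu : ContinuousOn u (Icc 0 S.ℓ) := by
    simpa [uIcc_of_le S.ℓ_pos.le] using h2.continuousOn
  have hv : ContinuousOn v (Icc 0 S.ℓ) := by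
    simpa [uIcc_of_le S.ℓ_pos.le] using h3.continuousOn
  have hcu : ContinuousOn (fun z => (starRingEnd ℂ) (u z)) (Icc 0 S.ℓ) :=
    Complex.continuous_conj.comp_continuousOn hu
  have hw : IntegrableOn w (Ioo 0 S.ℓ) := by
    have : IsFiniteMeasure S.μ := by unfold μ; infer_instance
    exact h6.integrable (by norm_num)
  have hint : IntegrableOn
      (fun z => (starRingEnd ℂ) (v z) * v z + (starRingEnd ℂ) (u z) * w z) (Ioo 0 S.ℓ) := by
    refine Integrable.add ?_ ?_
    · exact (((Complex.continuous_conj.comp_continuousOn hv).mul hv).integrableOn_Icc).mono_set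
        Ioo_subset_Icc_self
    · exact ((hw.congr_set_ae Ioo_ae_eq_Icc.symm).continuousOn_mul hcu isCompact_Icc).mono_set
        Ioo_subset_Icc_self
  -- The energy density left after integration by parts.
  let p : ℝ → ℝ := fun z => Complex.normSq (v z) + (S.m ^ 2 + S.V z) * Complex.normSq (u z)
  have hp : IntegrableOn p (Ioo 0 S.ℓ) := by
    refine (ContinuousOn.integrableOn_Icc ?_).mono_set Ioo_subset_Icc_self
    exact (Complex.continuous_normSq.comp_continuousOn hv).add
      ((continuousOn_const.add S.V_cont).mul (Complex.continuous_normSq.comp_continuousOn hu))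
  have hpc : IntegrableOn (fun z => (p z : ℂ)) (Ioo 0 S.ℓ) := hp.ofReal
  have hp0 : 0 ≤ ∫ z in Ioo 0 S.ℓ, p z := by
    refine setIntegral_nonneg measurableSet_Ioo fun z hz => ?_
    exact add_nonneg (Complex.normSq_nonneg _)
      (mul_nonneg (hmV z (Ioo_subset_Icc_self hz)) (Complex.normSq_nonneg _))
  have hac : AbsolutelyContinuousOnInterval (fun z => (starRingEnd ℂ) (u z) * v z) 0 S.ℓ := by
    have : AbsolutelyContinuousOnInterval (fun z => (starRingEnd ℂ) (u z)) 0 S.ℓ :=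
      h2.comp_of_dist_le fun x y => (Complex.dist_conj_conj _ _).le
    exact this.smul h3
  have hFTC := hac.setIntegral_Ioo_eq_sub S.ℓ_pos.le
    (f' := fun z => (starRingEnd ℂ) (v z) * v z + (starRingEnd ℂ) (u z) * w z) (by
      filter_upwards [h5, ae_restrict_mem (measurableSet_Ioo (a := (0 : ℝ)) (b := S.ℓ))]
        with z hz hz'
      have hd : HasDerivAt u (v z) z :=
        (h4 z (Ioo_subset_Icc_self hz')).hasDerivAt (Icc_mem_nhds hz'.1 hz'.2)
      exact (hd.star).mul hz) hint
  refine ⟨(∫ z in Ioo 0 S.ℓ, p z) + r₁ + r₂, by positivity, ?_⟩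
  have hbulk : ∫ z in Ioo 0 S.ℓ, (starRingEnd ℂ) (φ.fst z) * χ.fst z
      = ((∫ z in Ioo 0 S.ℓ, p z : ℝ) : ℂ)
        - ((starRingEnd ℂ) (u S.ℓ) * v S.ℓ - (starRingEnd ℂ) (u 0) * v 0) := by
    rw [← hFTC, ← integral_complex_ofReal, ← integral_sub hpc hint]
    refine integral_congr_ae ?_
    filter_upwards [h1, h9] with z a b
    simp only [a, b, p]
    push_cast
    rw [Complex.normSq_eq_conj_mul_self, Complex.normSq_eq_conj_mul_self]
    ring
  rw [S.inner_H, hbulk, h8, h10]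
  push_cast
  rw [← e₁, ← e₂]
  ring

end BulkBoundarySystem

/-! ### Conservation of energy for the abstract wave equation -/

namespace GraphDomain

section

variable {E : Type*} [NormedAddCommGroup E] [NormedSpace ℂ E] (A : E →ₗ.[ℂ] E)

/-- The inclusion of the domain with the graph norm as a continuous real-linear map. -/
noncomputable def inclCLM : GraphDomain A →L[ℝ] E :=
  ((incl A).restrictScalars ℝ).mkContinuous 1 fun φ => by
    rw [one_mul, norm_def]
    exact le_add_of_nonneg_right (norm_nonneg _)

/-- The operator as a continuous real-linear map on its domain with the graph norm. -/
noncomputable def opCLM : GraphDomain A →L[ℝ] E :=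
  ((op A).restrictScalars ℝ).mkContinuous 1 fun φ => by
    rw [one_mul, norm_def]
    exact le_add_of_nonneg_left (norm_nonneg _)

end

variable {E : Type*} [NormedAddCommGroup E] [InnerProductSpace ℂ E] {A : E →ₗ.[ℂ] E}

/-- An operator with real quadratic form is symmetric. -/
theorem re_inner_op_comm (hA : ∀ φ : GraphDomain A, (inner ℂ (incl A φ) (op A φ)).im = 0)
    (φ χ : GraphDomain A) :
    (inner ℂ (incl A φ) (op A χ)).re = (inner ℂ (op A φ) (incl A χ)).re := by
  have h1 := hA φ
  have h2 := hA χ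
  -- The factor `I` turns the imaginary part of the cross terms into the difference of the two real
  -- parts to be compared.
  have h3 := hA (φ + Complex.I • χ)
  simp only [map_add, map_smul, inner_add_left, inner_add_right, inner_smul_left,
    inner_smul_right, Complex.conj_I, Complex.add_im, Complex.mul_im, Complex.neg_im,
    Complex.neg_re, Complex.I_re, Complex.I_im, Complex.add_re, Complex.mul_re] at h3
  rw [← inner_conj_symm (op A φ) (incl A χ), Complex.conj_re]
  linarith

/-- The energy `‖∂ₜ g‖² + (g, A g)` of `g : ℝ → D(A)`. -/
noncomputable def energy (g : ℝ → GraphDomain A) (t : ℝ) : ℝ :=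
  ‖incl A (deriv g t)‖ ^ 2 + (inner ℂ (incl A (g t)) (op A (g t))).re

/-- The derivative is `2 Re(g', g'') + Re(g', A g) + Re(g, A g')`. The equation makes the first term
`-2 Re(g', A g)`, and by symmetry the other two add up to its negative. -/
theorem energy_eq (hA : ∀ φ : GraphDomain A, (inner ℂ (incl A φ) (op A φ)).im = 0)
    {g : ℝ → GraphDomain A} (hg : ContDiff ℝ 2 g)
    (hQ : ∀ t, incl A (iteratedDeriv 2 g t) + op A (g t) = 0) (s t : ℝ) :
    energy g s = energy g t := by
  have hd : ∀ t, HasDerivAt g (deriv g t) t := fun t =>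
    (hg.differentiable (by norm_num) t).hasDerivAt
  have hd2 : ∀ t, HasDerivAt (deriv g) (iteratedDeriv 2 g t) t := fun t => by
    rw [iteratedDeriv_succ, iteratedDeriv_one]
    have : ContDiff ℝ 1 (deriv g) := by
      have h := (contDiff_succ_iff_deriv (n := 1) (f := g) (𝕜 := ℝ)).1 (by rw [one_add_one_eq_two]; exact hg)
      exact h.2.2
    exact (this.differentiable (by norm_num) t).hasDerivAt
  have key : ∀ t, HasDerivAt (energy g) 0 t := fun t => by
    let : InnerProductSpace ℝ E := InnerProductSpace.rclikeToReal ℂ E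
    have hreal : ∀ x y : E, (inner ℂ x y).re = inner ℝ x y := fun x y => rfl
    have a1 : HasDerivAt (fun t => incl A (g t)) (incl A (deriv g t)) t :=
      (inclCLM A).hasFDerivAt.comp_hasDerivAt t (hd t)
    have a2 : HasDerivAt (fun t => op A (g t)) (op A (deriv g t)) t :=
      (opCLM A).hasFDerivAt.comp_hasDerivAt t (hd t)
    have a3 : HasDerivAt (fun t => incl A (deriv g t)) (incl A (iteratedDeriv 2 g t)) t :=
      (inclCLM A).hasFDerivAt.comp_hasDerivAt t (hd2 t)
    have b := a3.norm_sq.add (a1.inner ℝ a2)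
    refine (b.congr_deriv ?_ : HasDerivAt (energy g) 0 t)
    have c : incl A (iteratedDeriv 2 g t) = -op A (g t) := eq_neg_of_add_eq_zero_left (hQ t)
    have d := re_inner_op_comm hA (g t) (deriv g t)
    rw [hreal, hreal, real_inner_comm] at d
    rw [c, inner_neg_right]
    have e : inner ℝ (incl A (g t)) (op A (deriv g t))
        = inner ℝ (incl A (deriv g t)) (op A (g t)) := by
      rw [real_inner_comm, d, real_inner_comm]
    rw [e]
    ring
  exact is_const_of_deriv_eq_zero (fun t => (key t).differentiableAt) (fun t => (key t).deriv) s t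

/-- A solution with vanishing energy at one time is constant. -/
theorem eq_of_energy_eq_zero (hA : ∀ φ : GraphDomain A, (inner ℂ (incl A φ) (op A φ)).im = 0)
    (hA' : ∀ φ : GraphDomain A, 0 ≤ (inner ℂ (incl A φ) (op A φ)).re)
    {g : ℝ → GraphDomain A} (hg : ContDiff ℝ 2 g)
    (hQ : ∀ t, incl A (iteratedDeriv 2 g t) + op A (g t) = 0) {s : ℝ} (hs : energy g s = 0)
    (t : ℝ) : g t = g s := by
  refine is_const_of_deriv_eq_zero (hg.differentiable (by norm_num)) (fun t => ?_) t s
  have h := energy_eq hA hg hQ t s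
  rw [hs, energy] at h
  have h' : ‖incl A (deriv g t)‖ ^ 2 ≤ 0 := by linarith [hA' (g t)]
  have h'' : incl A (deriv g t) = 0 := by
    rw [← norm_eq_zero]
    exact pow_eq_zero_iff (two_ne_zero) |>.1 (le_antisymm h' (sq_nonneg _))
  exact incl_injective A (h''.trans (map_zero _).symm)

end GraphDomain

/-! ### Convolution with a test function -/

/-- A derivative of a convolution with a test function falls on the other factor. -/
theorem hasDerivAt_lsmul_convolution {F : Type*} [NormedAddCommGroup F] [NormedSpace ℝ F]
    {η : ℝ → ℝ} {g g' : ℝ → F} (hη : Continuous η) (hc : HasCompactSupport η)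
    (hg : ∀ t, HasDerivAt g (g' t) t) (hg' : Continuous g') (t : ℝ) :
    HasDerivAt (η ⋆[ContinuousLinearMap.lsmul ℝ ℝ] g)
      ((η ⋆[ContinuousLinearMap.lsmul ℝ ℝ] g') t) t := by
  have hgc : Continuous g := continuous_iff_continuousAt.2 fun t => (hg t).continuousAt
  have hcont : Continuous fun p : ℝ × ℝ => η p.2 • g' (p.1 - p.2) := by fun_prop
  -- A constant bound near `t` on the support of `η` dominates the differentiated integrand.
  obtain ⟨C, hC⟩ := ((isCompact_closedBall t 1).prod hc.isCompact).exists_bound_of_continuousOn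
    hcont.continuousOn
  refine (hasDerivAt_integral_of_dominated_loc_of_deriv_le (μ := volume)
    (F := fun x s => η s • g (x - s)) (F' := fun x s => η s • g' (x - s))
    (s := Metric.ball t 1) (bound := (tsupport η).indicator fun _ => C)
    (Metric.ball_mem_nhds t one_pos) ?_ ?_ ?_ ?_ ?_ ?_).2
  · exact Eventually.of_forall fun x =>
      (by fun_prop : Continuous fun s => η s • g (x - s)).aestronglyMeasurable
  · exact (by fun_prop : Continuous fun s => η s • g (t - s)).integrable_of_hasCompactSupport
      hc.smul_right
  · exact (by fun_prop : Continuous fun s => η s • g' (t - s)).aestronglyMeasurable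
  · refine Eventually.of_forall fun s x hx => ?_
    by_cases hs : s ∈ tsupport η
    · rw [indicator_of_mem hs]
      exact hC (x, s) ⟨Metric.ball_subset_closedBall hx, hs⟩
    · rw [indicator_of_notMem hs, image_eq_zero_of_notMem_tsupport hs]
      simp
  · exact (integrable_indicator_iff (isClosed_tsupport η).measurableSet).2
      (integrableOn_const hc.isCompact.measure_lt_top.ne)
  · refine Eventually.of_forall fun s x _ => ?_
    exact ((hg (x - s)).comp_sub_const x s).const_smul (η s)

namespace BulkBoundarySystem

/-! ### Supports -/

theorem toH_injective (S : BulkBoundarySystem) : Function.Injective S.toH :=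
  GraphDomain.incl_injective S.A

theorem bulk_zero (S : BulkBoundarySystem) {z : ℝ} (hz : z ∈ Icc 0 S.ℓ) : S.bulk 0 z = 0 := by
  refine S.eqOn_of_ae (u' := 0) ?_ (S.bulk_spec 0).1 continuousOn_const hz
  have h := (S.bulk_spec 0).2
  rw [map_zero] at h
  exact h.symm.trans (Lp.coeFn_zero ℂ 2 S.μ)

/-- An element of `D(A)` is determined by its bulk component. -/
theorem eq_zero_of_bulk (S : BulkBoundarySystem) {φ : S.DA}
    (h : ∀ z ∈ Icc 0 S.ℓ, S.bulk φ z = 0) : φ = 0 := by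
  obtain ⟨u, v, w, h1, h2, -, h4, -, -, -, h8, -⟩ := S.isGraphPair φ
  have hu : EqOn u 0 (Icc 0 S.ℓ) := fun z hz => by
    rw [S.eqOn_of_ae (h1.symm.trans (S.bulk_spec φ).2)
      (by simpa [uIcc_of_le S.ℓ_pos.le] using h2.continuousOn) (S.bulk_spec φ).1 hz, h z hz]
    rfl
  -- One-sided derivatives give `v = 0` at `ℓ` too, so the boundary component vanishes with the bulk
  -- one.
  have hv : EqOn v 0 (Icc 0 S.ℓ) := fun z hz => by
    have a := (hasDerivWithinAt_const z (Icc 0 S.ℓ) (0 : ℂ)).congr hu (hu hz)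
    exact (uniqueDiffOn_Icc S.ℓ_pos z hz).eq_deriv _ (h4 z hz) a
  have hfst : (S.toH φ).fst = 0 := by
    refine Lp.ext ?_
    filter_upwards [h1, Lp.coeFn_zero ℂ 2 S.μ,
      ae_restrict_mem (measurableSet_Ioo (a := (0 : ℝ)) (b := S.ℓ))] with z a c hz
    rw [a, c, hu (Ioo_subset_Icc_self hz)]
  have hsnd : (S.toH φ).snd = 0 := by
    rw [h8, hu (right_mem_Icc.2 S.ℓ_pos.le), hv (right_mem_Icc.2 S.ℓ_pos.le)]
    simp
    rfl
  refine S.toH_injective ?_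
  rw [map_zero]
  exact WithLp.ofLp_injective 2 (Prod.ext hfst hsnd)

theorem eq_zero_of_notMem_suppBulk (S : BulkBoundarySystem) {f : ℝ → S.DA} {t : ℝ}
    (h : ∀ z, (t, z) ∉ S.suppBulk f) : f t = 0 :=
  S.eq_zero_of_bulk fun z hz => by
    by_contra hne
    exact h z (subset_closure ⟨hz, hne⟩)

theorem exists_suppBulk_bounds (S : BulkBoundarySystem) (f : S.C2c) :
    ∃ R : ℝ, ∀ x ∈ S.suppBulk f.1, |x.1| ≤ R := by
  obtain ⟨R, hR⟩ := f.2.2.isCompact.isBounded.exists_norm_le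
  refine ⟨R, fun x hx => ?_⟩
  have hcl : IsClosed {x : ℝ × ℝ | |x.1| ≤ R} :=
    isClosed_le (continuous_abs.comp continuous_fst) continuous_const
  refine closure_minimal (fun y hy => ?_) hcl hx
  refine hR y.1 (subset_tsupport _ fun h0 => hy.2 ?_)
  rw [h0, S.bulk_zero hy.1]

/-! ### Uniqueness for the wave equation -/

/-- Two solutions of the same inhomogeneous wave equation that agree near some time are equal. -/
theorem eq_of_Q_eq (S : BulkBoundarySystem)
    (hA : ∀ φ : S.DA, ∃ r : ℝ, 0 ≤ r ∧ inner ℂ (S.toH φ) (S.opA φ) = (r : ℂ)) {f g : ℝ → S.DA}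
    (hf : ContDiff ℝ 2 f) (hg : ContDiff ℝ 2 g) (hQ : ∀ t, S.Q f t = S.Q g t) {s : ℝ}
    (hs : f =ᶠ[𝓝 s] g) : f = g := by
  have hA₁ : ∀ φ : S.DA, (inner ℂ (S.toH φ) (S.opA φ)).im = 0 := fun φ => by
    obtain ⟨r, -, e⟩ := hA φ
    rw [e, Complex.ofReal_im]
  have hA₂ : ∀ φ : S.DA, 0 ≤ (inner ℂ (S.toH φ) (S.opA φ)).re := fun φ => by
    obtain ⟨r, hr, e⟩ := hA φ
    rwa [e, Complex.ofReal_re]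
  have hz : (f - g) =ᶠ[𝓝 s] fun _ => 0 := by
    filter_upwards [hs] with t ht
    rw [Pi.sub_apply, ht, sub_self]
  have hQ0 : ∀ t, S.toH (iteratedDeriv 2 (f - g) t) + S.opA ((f - g) t) = 0 := fun t => by
    rw [iteratedDeriv_sub hf.contDiffAt hg.contDiffAt, Pi.sub_apply, map_sub, map_sub,
      sub_add_sub_comm]
    exact sub_eq_zero.2 (hQ t)
  have he : GraphDomain.energy (f - g) s = 0 := by
    rw [GraphDomain.energy, hz.deriv_eq, hz.eq_of_nhds]
    simp
  funext t
  have h := GraphDomain.eq_of_energy_eq_zero hA₁ hA₂ (hf.sub hg) hQ0 he t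
  exact sub_eq_zero.1 (h.trans hz.eq_of_nhds)

/-- Two right inverses of `Q_A` whose values vanish near a common time are equal. -/
theorem green_unique (S : BulkBoundarySystem)
    (hA : ∀ φ : S.DA, ∃ r : ℝ, 0 ≤ r ∧ inner ℂ (S.toH φ) (S.opA φ) = (r : ℂ))
    {T₁ T₂ : S.C2c → S.C2}
    (hQ₁ : ∀ (f : S.C2c) (t : ℝ), S.Q (T₁ f).1 t = S.toH (f.1 t))
    (hQ₂ : ∀ (f : S.C2c) (t : ℝ), S.Q (T₂ f).1 t = S.toH (f.1 t))
    (h : ∀ f : S.C2c, ∃ s : ℝ, ∀ᶠ t in 𝓝 s, ∀ z,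
      (t, z) ∉ S.suppBulk (T₁ f).1 ∧ (t, z) ∉ S.suppBulk (T₂ f).1) : T₁ = T₂ := by
  funext f
  obtain ⟨s, hs⟩ := h f
  refine Subtype.ext (S.eq_of_Q_eq hA (T₁ f).2 (T₂ f).2
    (fun t => (hQ₁ f t).trans (hQ₂ f t).symm) (s := s) ?_)
  filter_upwards [hs] with t ht
  rw [S.eq_zero_of_notMem_suppBulk fun z => (ht z).1,
    S.eq_zero_of_notMem_suppBulk fun z => (ht z).2]

/-- Both outputs vanish before time `-R` when the source lives in `|t| ≤ R`. -/
theorem advancedGreen_unique (S : BulkBoundarySystem)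
    (hA : ∀ φ : S.DA, ∃ r : ℝ, 0 ≤ r ∧ inner ℂ (S.toH φ) (S.opA φ) = (r : ℂ))
    {T₁ T₂ : S.C2c → S.C2} (h₁ : S.IsAdvancedGreen T₁) (h₂ : S.IsAdvancedGreen T₂) :
    T₁ = T₂ := by
  obtain ⟨-, -, hQ₁, -, hs₁⟩ := h₁
  obtain ⟨-, -, hQ₂, -, hs₂⟩ := h₂
  refine S.green_unique hA hQ₁ hQ₂ fun f => ?_
  obtain ⟨R, hR⟩ := S.exists_suppBulk_bounds f
  have key : ∀ t < -R, ∀ z, (t, z) ∉ S.JPlus (S.suppBulk f.1) := by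
    rintro t ht z ⟨-, y, hy, hle⟩
    have := (abs_le.1 (hR y hy)).1
    have := (abs_nonneg _).trans hle
    dsimp only at this
    linarith
  refine ⟨-R - 1, ?_⟩
  filter_upwards [Iio_mem_nhds (show -R - 1 < -R by linarith)] with t ht z
  exact ⟨fun h => key t ht z (hs₁ f h), fun h => key t ht z (hs₂ f h)⟩

theorem retardedGreen_unique (S : BulkBoundarySystem)
    (hA : ∀ φ : S.DA, ∃ r : ℝ, 0 ≤ r ∧ inner ℂ (S.toH φ) (S.opA φ) = (r : ℂ))
    {T₁ T₂ : S.C2c → S.C2} (h₁ : S.IsRetardedGreen T₁) (h₂ : S.IsRetardedGreen T₂) :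
    T₁ = T₂ := by
  obtain ⟨-, -, hQ₁, -, hs₁⟩ := h₁
  obtain ⟨-, -, hQ₂, -, hs₂⟩ := h₂
  refine S.green_unique hA hQ₁ hQ₂ fun f => ?_
  obtain ⟨R, hR⟩ := S.exists_suppBulk_bounds f
  have key : ∀ t > R, ∀ z, (t, z) ∉ S.JMinus (S.suppBulk f.1) := by
    rintro t ht z ⟨-, y, hy, hle⟩
    have := (abs_le.1 (hR y hy)).2
    have := (abs_nonneg _).trans hle
    dsimp only at this
    linarith
  refine ⟨R + 1, ?_⟩
  filter_upwards [Ioi_mem_nhds (show R < R + 1 by linarith)] with t ht z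
  exact ⟨fun h => key t ht z (hs₁ f h), fun h => key t ht z (hs₂ f h)⟩

/-! ### Causal propagators -/

/-- The element `t ↦ η(t) φ` of `C²₀(ℝ, D(A))`. -/
noncomputable def testFunction (S : BulkBoundarySystem) {η : ℝ → ℝ} (hη : ContDiff ℝ 2 η)
    (hc : HasCompactSupport η) (φ : S.DA) : S.C2c :=
  ⟨fun t => η t • φ, hη.smul contDiff_const, hc.smul_right⟩

/-- This exhibits the mollified orbit `E(t) φ` as the image of a `D(A)`-valued function. -/
theorem toH_apply_testFunction (S : BulkBoundarySystem) {T : S.C2c → S.C2}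
    {E : ℝ → S.H →L[ℂ] S.H} (hT : S.IsIntegralOperator T E) {η : ℝ → ℝ} (hη : ContDiff ℝ 2 η)
    (hc : HasCompactSupport η) (φ : S.DA) (t : ℝ) :
    S.toH ((T (S.testFunction hη hc φ)).1 t)
      = (η ⋆[ContinuousLinearMap.lsmul ℝ ℝ] fun t => E t (S.toH φ)) t := by
  rw [hT.eq_integral]
  refine integral_congr_ae (Eventually.of_forall fun s => ?_)
  have h : S.toH (η s • φ) = η s • S.toH φ := (GraphDomain.inclCLM S.A).map_smul (η s) φ
  change E (t - s) (S.toH (η s • φ)) = η s • E (t - s) (S.toH φ)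
  rw [h, ContinuousLinearMap.map_smul_of_tower]

/-- Energy conservation for the mollification of a function with `D(A)`-valued mollifications. -/
theorem norm_sq_convolution_le (S : BulkBoundarySystem)
    (hA : ∀ φ : S.DA, ∃ r : ℝ, 0 ≤ r ∧ inner ℂ (S.toH φ) (S.opA φ) = (r : ℂ))
    {G : ℝ → S.DA} (hG : ContDiff ℝ 2 G) (hQ : ∀ t, S.Q G t = 0) {η : ℝ → ℝ}
    (hη : Continuous η) (hc : HasCompactSupport η) {g g' g'' : ℝ → S.H}
    (hg : ∀ t, HasDerivAt g (g' t) t) (hg' : ∀ t, HasDerivAt g' (g'' t) t)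
    (hg'' : Continuous g'')
    (hGg : ∀ t, S.toH (G t) = (η ⋆[ContinuousLinearMap.lsmul ℝ ℝ] g) t) (t : ℝ) :
    ‖(η ⋆[ContinuousLinearMap.lsmul ℝ ℝ] g') t‖ ^ 2
      ≤ ‖(η ⋆[ContinuousLinearMap.lsmul ℝ ℝ] g') 0‖ ^ 2
        + (inner ℂ ((η ⋆[ContinuousLinearMap.lsmul ℝ ℝ] g) 0)
          (-(η ⋆[ContinuousLinearMap.lsmul ℝ ℝ] g'') 0)).re := by
  have hA₁ : ∀ φ : S.DA, (inner ℂ (S.toH φ) (S.opA φ)).im = 0 := fun φ => by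
    obtain ⟨r, -, e⟩ := hA φ
    rw [e, Complex.ofReal_im]
  have hg'c : Continuous g' := continuous_iff_continuousAt.2 fun t => (hg' t).continuousAt
  have hd : ∀ t, HasDerivAt G (deriv G t) t := fun t =>
    (hG.differentiable (by norm_num) t).hasDerivAt
  have hd2 : ∀ t, HasDerivAt (deriv G) (iteratedDeriv 2 G t) t := fun t => by
    rw [iteratedDeriv_succ, iteratedDeriv_one]
    have h := (contDiff_succ_iff_deriv (n := 1) (f := G) (𝕜 := ℝ)).1
      (by rw [one_add_one_eq_two]; exact hG)
    exact (h.2.2.differentiable (by norm_num) t).hasDerivAt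
  have e0 : (fun t => S.toH (G t)) = η ⋆[ContinuousLinearMap.lsmul ℝ ℝ] g := funext hGg
  have e1 : (fun t => S.toH (deriv G t)) = η ⋆[ContinuousLinearMap.lsmul ℝ ℝ] g' := by
    funext t
    have h1 : HasDerivAt (fun t => S.toH (G t)) (S.toH (deriv G t)) t :=
      (GraphDomain.inclCLM S.A).hasFDerivAt.comp_hasDerivAt t (hd t)
    rw [e0] at h1
    exact h1.unique (hasDerivAt_lsmul_convolution hη hc hg hg'c t)
  have e2 : ∀ t, S.toH (iteratedDeriv 2 G t) = (η ⋆[ContinuousLinearMap.lsmul ℝ ℝ] g'') t := by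
    intro t
    have h1 : HasDerivAt (fun t => S.toH (deriv G t)) (S.toH (iteratedDeriv 2 G t)) t :=
      (GraphDomain.inclCLM S.A).hasFDerivAt.comp_hasDerivAt t (hd2 t)
    rw [e1] at h1
    exact h1.unique (hasDerivAt_lsmul_convolution hη hc hg' hg'' t)
  have hE := GraphDomain.energy_eq hA₁ hG hQ t 0
  unfold GraphDomain.energy at hE
  -- Trading `A G(0)` for `-∂ₜ² G(0)` leaves only mollifications of `g`, `g'`, `g''`; at time `t`
  -- the form is dropped as nonnegative.
  have hop : S.opA (G 0) = -S.toH (iteratedDeriv 2 G 0) :=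
    eq_neg_of_add_eq_zero_right (hQ 0)
  obtain ⟨r, hr, e⟩ := hA (G t)
  rw [e, hop, e2, hGg, Complex.ofReal_re] at hE
  rw [← e1]
  dsimp only
  linarith

/-- A `C²` function with vanishing initial data all of whose mollifications are `D(A)`-valued
solutions of the wave equation vanishes. -/
theorem eq_zero_of_mollified_wave (S : BulkBoundarySystem)
    (hA : ∀ φ : S.DA, ∃ r : ℝ, 0 ≤ r ∧ inner ℂ (S.toH φ) (S.opA φ) = (r : ℂ))
    {g : ℝ → S.H} (hg : ContDiff ℝ 2 g) (h0 : g 0 = 0) (h1 : deriv g 0 = 0)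
    (hG : ∀ η : ℝ → ℝ, ContDiff ℝ 2 η → HasCompactSupport η → ∃ G : ℝ → S.DA,
      ContDiff ℝ 2 G ∧ (∀ t, S.Q G t = 0) ∧
      ∀ t, S.toH (G t) = (η ⋆[ContinuousLinearMap.lsmul ℝ ℝ] g) t) (t : ℝ) : g t = 0 := by
  have hdg : ContDiff ℝ 1 (deriv g) :=
    ((contDiff_succ_iff_deriv (n := 1) (f := g) (𝕜 := ℝ)).1
      (by rw [one_add_one_eq_two]; exact hg)).2.2
  have hd : ∀ t, HasDerivAt g (deriv g t) t := fun t =>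
    (hg.differentiable (by norm_num) t).hasDerivAt
  have hd2 : ∀ t, HasDerivAt (deriv g) (deriv (deriv g) t) t := fun t =>
    (hdg.differentiable (by norm_num) t).hasDerivAt
  have hc2 : Continuous (deriv (deriv g)) := hdg.continuous_deriv le_rfl
  -- Bumps of radius `1 / (n + 1)`; once normalized they form an approximate identity.
  let b : ℕ → ContDiffBump (0 : ℝ) := fun n =>
    ⟨1 / (n + 1) / 2, 1 / (n + 1), by positivity, half_lt_self (by positivity)⟩
  have hb : Tendsto (fun n => (b n).rOut) atTop (𝓝 0) := tendsto_one_div_add_atTop_nhds_zero_nat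
  have lim : ∀ {k : ℝ → S.H}, Continuous k → ∀ s, Tendsto
      (fun n => ((b n).normed volume ⋆[ContinuousLinearMap.lsmul ℝ ℝ] k) s) atTop (𝓝 (k s)) :=
    fun hk s => ContDiffBump.convolution_tendsto_right_of_continuous hb hk s
  have hderiv : ∀ s, deriv g s = 0 := fun s => by
    -- In the limit `‖g'(s)‖² ≤ ‖g'(0)‖² + Re(g(0), -g''(0))`, and the initial data make the right
    -- side zero.
    have hle := le_of_tendsto_of_tendsto' (((lim hdg.continuous s).norm).pow 2)
      ((((lim hdg.continuous 0).norm).pow 2).add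
        ((Complex.continuous_re.tendsto _).comp
          ((lim hg.continuous 0).inner ((lim hc2 0).neg)))) (fun n => by
        obtain ⟨G, hG1, hG2, hG3⟩ := hG _ ((b n).contDiff_normed (μ := volume))
          ((b n).hasCompactSupport_normed)
        exact S.norm_sq_convolution_le hA hG1 hG2 (b n).continuous_normed
          (b n).hasCompactSupport_normed hd hd2 hc2 hG3 s)
    rw [h0, h1, inner_zero_left] at hle
    rw [← norm_eq_zero]
    refine (pow_eq_zero_iff two_ne_zero).1 (le_antisymm ?_ (sq_nonneg _))
    simpa using hle
  rw [is_const_of_deriv_eq_zero (hg.differentiable (by norm_num)) hderiv t 0, h0]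

theorem causalPropagator_unique (S : BulkBoundarySystem)
    (hA : ∀ φ : S.DA, ∃ r : ℝ, 0 ≤ r ∧ inner ℂ (S.toH φ) (S.opA φ) = (r : ℂ))
    {T₁ T₂ : S.C2c → S.C2} (h₁ : S.IsCausalPropagator T₁) (h₂ : S.IsCausalPropagator T₂) :
    T₁ = T₂ := by
  obtain ⟨E₁, hT₁, hC₁, hQ₁, -, -, hz₁, hd₁⟩ := h₁
  obtain ⟨E₂, hT₂, hC₂, hQ₂, -, -, hz₂, hd₂⟩ := h₂
  -- Agreement of the kernels on `D(A)` suffices, as test functions take their values there.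
  have key : ∀ (φ : S.DA) (t : ℝ), E₁ t (S.toH φ) = E₂ t (S.toH φ) := fun φ t => by
    refine sub_eq_zero.1 (S.eq_zero_of_mollified_wave hA
      (g := (fun t => E₁ t (S.toH φ)) - fun t => E₂ t (S.toH φ)) ((hC₁ φ).sub (hC₂ φ)) ?_ ?_ ?_ t)
    · simp [hz₁, hz₂]
    · rw [((hd₁ φ).sub (hd₂ φ)).deriv, sub_self]
    · intro η hη hc
      refine ⟨(T₁ (S.testFunction hη hc φ)).1 - (T₂ (S.testFunction hη hc φ)).1,
        (T₁ _).2.sub (T₂ _).2, fun t => ?_, fun t => ?_⟩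
      · unfold Q
        rw [iteratedDeriv_sub (T₁ _).2.contDiffAt (T₂ _).2.contDiffAt, Pi.sub_apply, map_sub,
          map_sub, sub_add_sub_comm]
        exact sub_eq_zero.2 ((hQ₁ _ t).trans (hQ₂ _ t).symm)
      · have hcont : ∀ {k : ℝ → S.H}, Continuous k →
            ConvolutionExistsAt η k t (ContinuousLinearMap.lsmul ℝ ℝ) volume := fun hk =>
          hc.convolutionExists_left _ hη.continuous hk.locallyIntegrable t
        rw [Pi.sub_apply, map_sub, S.toH_apply_testFunction hT₁, S.toH_apply_testFunction hT₂]
        simp only [convolution]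
        rw [← integral_sub (hcont (hC₁ φ).continuous) (hcont (hC₂ φ).continuous)]
        simp only [Pi.sub_apply, map_sub]
  funext f
  refine Subtype.ext (funext fun t => S.toH_injective ?_)
  rw [hT₁.eq_integral, hT₂.eq_integral]
  simp only [convolve, key]

end BulkBoundarySystem

theorem mainTheorem3 (S : BulkBoundarySystem)
    (hmV : ∀ z ∈ Set.Icc 0 S.ℓ, 0 ≤ S.m ^ 2 + S.V z)
    (hα : S.α = 0 ∨ (Real.pi / 2 ≤ S.α ∧ S.α < Real.pi))
    (hβ₂' : S.β₂' ≠ 0)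
    (hpos : 0 < S.β₂' → 0 ≤ S.β₁ ∧ S.β₂ < 0 ∧ S.β₁' < 0)
    (hneg : S.β₂' < 0 → S.β₁ ≤ 0 ∧ 0 < S.β₂ ∧ 0 < S.β₁')
    (hβ₂ : S.β₂ ≠ 0) :
    (∀ T₁ T₂ : S.C2c → S.C2, S.IsAdvancedGreen T₁ → S.IsAdvancedGreen T₂ → T₁ = T₂) ∧
    (∀ T₁ T₂ : S.C2c → S.C2, S.IsRetardedGreen T₁ → S.IsRetardedGreen T₂ → T₁ = T₂) ∧
    (∀ T₁ T₂ : S.C2c → S.C2, S.IsCausalPropagator T₁ → S.IsCausalPropagator T₂ → T₁ = T₂) := by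
  have hA : ∀ φ : S.DA, ∃ r : ℝ, 0 ≤ r ∧ inner ℂ (S.toH φ) (S.opA φ) = (r : ℂ) := fun φ =>
    S.exists_inner_eq_of_isGraphPair hmV hα hβ₂' hpos hneg (S.isGraphPair φ)
  exact ⟨fun _ _ => S.advancedGreen_unique hA, fun _ _ => S.retardedGreen_unique hA,
    fun _ _ => S.causalPropagator_unique hA⟩
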